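/- Let $\eta(z)=q^{1/24}\prod_{n\ge 1}(1-q^n)$, where $q=e^{2\pi i z}$ and $q^{1/24}=e^{2\pi i z/24}$, be Dedekind's eta function on the upper half plane. For an integer $k$, an integer $N\ge 1$ and a Dirichlet character $\chi$ modulo $N$, let $M_k(N,\chi)$ be the space of modular forms $f$ of weight $k$ on $\Gamma_1(N)$ such that $(cz+d)^{-k}f\left(\frac{az+b}{cz+d}\right)=\chi(d)f(z)$ for all $\begin{pmatrix}a&b\\c&d\end{pmatrix}\in\Gamma_0(N)$. Then for every integer $k\ge 0$, \[ \frac{\eta(8z)^{4k}}{\eta(4z)^{2k}}\in M_k(8,\chi), \] where $\chi$ is the Dirichlet character modulo $8$ given by the Kronecker symbol $\chi(n)=\left(\frac{(-1)^k}{n}\right)$ for all integers $n$ coprime to $8$. -/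

import Mathlib

open scoped MatrixGroups ModularForm

/-- The Kronecker symbol `(a / n)` for arbitrary integers `a`, `n`: the completely multiplicative
(in `n`) extension of the Jacobi symbol determined by `(a / -1) = -1` if `a < 0` and `1` otherwise,
`(a / 2) = 0` if `a` is even, `1` if `a ≡ ± 1 (mod 8)`, `-1` if `a ≡ ± 3 (mod 8)` (this is the
value of `ZMod.χ₈` at `a`), and by `(a / 0) = 1` if `a = ± 1` and `0` otherwise. -/
def kroneckerSymbol (a n : ℤ) : ℤ :=
  if n = 0 then
    if a.natAbs = 1 then 1 else 0
  else
    (if n < 0 ∧ a < 0 then -1 else 1) * ZMod.χ₈ (a : ZMod 8) ^ n.natAbs.factorization 2 *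
      jacobiSym a (n.natAbs / 2 ^ n.natAbs.factorization 2)

/-- The space `M_k(N, χ)` of modular forms of weight `k`, level `N` and character `χ`: those
modular forms `f` of weight `k` on `Γ₁(N)` that satisfy `f ∣[k] γ = χ(d) f` for every matrix
`γ = (a b; c d)` in `Γ₀(N)`. -/
def modularFormsWithCharacter (k : ℤ) (N : ℕ) (χ : DirichletCharacter ℂ N) :
    Submodule ℂ (ModularForm
      ((CongruenceSubgroup.Gamma1 N).map (Matrix.SpecialLinearGroup.mapGL ℝ)) k) where
  carrier := {f | ∀ γ ∈ CongruenceSubgroup.Gamma0 N,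
    (⇑f : UpperHalfPlane → ℂ) ∣[k] γ = χ ((γ 1 1 : ℤ) : ZMod N) • (⇑f : UpperHalfPlane → ℂ)}
  add_mem' {f g} hf hg γ hγ := by
    simp only [FunLike.coe_add, SlashAction.add_slash, hf γ hγ, hg γ hγ, smul_add]
  zero_mem' γ _ := by
    simp only [FunLike.coe_zero, SlashAction.zero_slash, smul_zero]
  smul_mem' c f hf γ hγ := by
    simp only [FunLike.coe_smul, ModularForm.SL_smul_slash, hf γ hγ, smul_comm c]

namespace ModularForm

open UpperHalfPlane hiding I
open Complex Function Filter Topology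

/-! The quotient is `(θ₂²(4z) / 4) ^ k`, where `θ₂² = 4 η(2τ)⁴ / η(τ)²`. The rules for eta under `T`
and `S` show that `θ₂²`, `θ₃²`, `θ₄²` are permuted in weight 1 up to powers of `I`. Hence every `θ₂²
∣[1] γ` is a power of `I` times one of them, both determined by `γ` modulo 4 (`thetaTwoSq_slash`).
All three are bounded at infinity, which gives boundedness at every cusp. When `4 ∣ b` and `2 ∣ c`
the factor is `I ^ (1 - d) = χ₄(d)`, and conjugation by `diag(4, 1)` carries `Γ₀(8)` into this
group. Finally `χ₄ ^ k` is the Kronecker symbol of `(-1) ^ k`. -/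

lemma eta_add_one (z : ℂ) : eta (z + 1) = cexp (2 * Real.pi * I / 24) * eta z := by
  have h1 (n : ℕ) : eta_q n (z + 1) = eta_q n z := by
    rw [eta_q, eta_q, show Periodic.qParam 1 (z + 1) = Periodic.qParam 1 z by
      simp [Periodic.qParam, mul_add, Complex.exp_add]]
  simp only [eta, h1, ← mul_assoc]
  congr 1
  rw [Periodic.qParam, Periodic.qParam, ← Complex.exp_add]
  congr 1
  push_cast
  ring

lemma exp_two_pi_I_div_24_pow_six : cexp (2 * Real.pi * I / 24) ^ 6 = I := by
  rw [← Complex.exp_nat_mul]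
  convert! Complex.exp_pi_div_two_mul_I using 2
  push_cast
  ring

/-- Squaring removes the square-root branches of the inversion formula; only even powers of eta are
needed. -/
lemma eta_neg_inv_sq {z : ℂ} (hz : 0 < z.im) : eta (-1 / z) ^ 2 = -I * z * eta z ^ 2 := by
  have h := eta_comp_eq_csqrt_I_inv hz
  have hs (w : ℂ) (hw : w ≠ 0) : sqrt w ^ 2 = w := by
    rw [sqrt_eq_exp hw, ← Complex.exp_nat_mul]
    push_cast
    rw [mul_div_cancel₀ _ two_ne_zero, Complex.exp_log hw]
  have hz0 : z ≠ 0 := by rintro rfl; simp at hz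
  simp only [Function.comp_apply, Pi.smul_apply, Pi.mul_apply, smul_eq_mul] at h
  rw [h, mul_pow, mul_pow, inv_pow, hs _ I_ne_zero, hs _ hz0, Complex.inv_I]
  ring

lemma eta_neg_inv_pow_four {z : ℂ} (hz : 0 < z.im) : eta (-1 / z) ^ 4 = -z ^ 2 * eta z ^ 4 := by
  rw [show 4 = 2 * 2 from rfl, pow_mul, eta_neg_inv_sq hz]
  ring_nf
  simp

lemma im_neg_inv_pos {z : ℂ} (hz : 0 < z.im) : 0 < (-1 / z).im := by
  simpa [neg_div] using UpperHalfPlane.im_inv_neg_coe_pos ⟨z, hz⟩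

/-! ### Squares of the theta constants under `T` and `S` -/

/-- The eta quotient `4 η(2τ)⁴ / η(τ)²`, which is the square of the theta constant `θ₂`. -/
noncomputable def thetaTwoSq (τ : ℂ) : ℂ := 4 * eta (2 * τ) ^ 4 / eta τ ^ 2

/-- The eta quotient `η(τ / 2)⁴ / η(τ)²`, which is the square of the theta constant `θ₄`. -/
noncomputable def thetaFourSq (τ : ℂ) : ℂ := eta (τ / 2) ^ 4 / eta τ ^ 2

/-- The translate of `thetaFourSq` by `1`, which is the square of the theta constant `θ₃`. -/
noncomputable def thetaThreeSq (τ : ℂ) : ℂ := thetaFourSq (τ + 1)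

lemma thetaTwoSq_add_one (τ : ℂ) : thetaTwoSq (τ + 1) = I * thetaTwoSq τ := by
  have h0 := Complex.exp_ne_zero (2 * Real.pi * I / 24)
  rw [thetaTwoSq, thetaTwoSq, show 2 * (τ + 1) = 2 * τ + 1 + 1 by ring, eta_add_one, eta_add_one,
    eta_add_one]
  nth_rewrite 4 [← exp_two_pi_I_div_24_pow_six]
  field_simp

lemma thetaThreeSq_add_one (τ : ℂ) : thetaThreeSq (τ + 1) = thetaFourSq τ := by
  have h0 := Complex.exp_ne_zero (2 * Real.pi * I / 24)
  rw [thetaThreeSq, thetaFourSq, thetaFourSq, show (τ + 1 + 1) / 2 = τ / 2 + 1 by ring, eta_add_one,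
    eta_add_one, eta_add_one]
  field_simp

lemma thetaTwoSq_neg_inv {τ : ℂ} (hτ : 0 < τ.im) :
    thetaTwoSq (-1 / τ) = -I * τ * thetaFourSq τ := by
  have h0 : τ ≠ 0 := by rintro rfl; simp at hτ
  have h2 : 0 < (τ / 2).im := by simpa using hτ
  have he := eta_ne_zero hτ
  rw [thetaTwoSq, thetaFourSq, show 2 * (-1 / τ) = -1 / (τ / 2) by field_simp,
    eta_neg_inv_pow_four h2, eta_neg_inv_sq hτ]
  field_simp
  ring_nf
  simp

lemma thetaFourSq_neg_inv {τ : ℂ} (hτ : 0 < τ.im) :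
    thetaFourSq (-1 / τ) = -I * τ * thetaTwoSq τ := by
  have h0 : τ ≠ 0 := by rintro rfl; simp at hτ
  have h2 : 0 < (2 * τ).im := by simpa using hτ
  have he := eta_ne_zero hτ
  rw [thetaTwoSq, thetaFourSq, show -1 / τ / 2 = -1 / (2 * τ) by field_simp,
    eta_neg_inv_pow_four h2, eta_neg_inv_sq hτ]
  field_simp
  ring_nf
  simp

lemma thetaThreeSq_neg_inv {τ : ℂ} (hτ : 0 < τ.im) :
    thetaThreeSq (-1 / τ) = -I * τ * thetaThreeSq τ := by
  have h0 : τ ≠ 0 := by rintro rfl; simp at hτ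
  have hζ := Complex.exp_ne_zero (2 * Real.pi * I / 24)
  have hζ6 := exp_two_pi_I_div_24_pow_six
  have he := eta_ne_zero hτ
  -- The argument `(-1/τ + 1) / 2` is `S T⁻² S` applied to `w`, so two inversions and two
  -- translations relate its eta value to `eta w`.
  set w : ℂ := (τ - 1) / 2 with hw
  have hwi : 0 < w.im := by simpa [hw] using hτ
  have hw0 : w ≠ 0 := by rintro h; simp [h] at hwi
  set y : ℂ := -1 / w - 1 - 1 with hy
  have hyi : 0 < y.im := by simpa [hy] using im_neg_inv_pos hwi
  have hy0 : y ≠ 0 := by rintro h; simp [h] at hyi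
  have hyw : y * w = -τ := by
    have : y * w = -1 - 2 * w := by rw [hy]; field_simp; ring
    rw [this, hw]
    ring
  have h1 : eta (-1 / y) ^ 4 = -y ^ 2 * eta y ^ 4 := eta_neg_inv_pow_four hyi
  have h2 : eta (-1 / w) ^ 4 = -w ^ 2 * eta w ^ 4 := eta_neg_inv_pow_four hwi
  have h3 := eta_add_one (y + 1)
  rw [eta_add_one y, show y + 1 + 1 = -1 / w by rw [hy]; ring] at h3
  have h4 : (-1 / τ + 1) / 2 = -1 / y := by
    rw [div_add_one h0, div_div, div_eq_div_iff (by simpa using h0) hy0]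
    linear_combination 2 * hyw - 2 * y * hw
  rw [thetaThreeSq, thetaThreeSq, thetaFourSq, thetaFourSq, h4, h1, eta_add_one, eta_add_one,
    show (τ + 1) / 2 = w + 1 by rw [hw]; ring, eta_add_one, mul_pow, mul_pow, eta_neg_inv_sq hτ]
  rw [h3, mul_pow, mul_pow] at h2
  generalize cexp (2 * Real.pi * I / 24) = ζ at *
  field_simp
  have h5 : ζ ^ 8 * y ^ 2 * eta y ^ 4 = -τ ^ 2 * eta w ^ 4 := by
    linear_combination y ^ 2 * h2 - (y * w - τ) * eta w ^ 4 * hyw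
  have h6 : ζ ^ 12 = -1 := by rw [show 12 = 6 * 2 from rfl, pow_mul, hζ6, I_sq]
  -- The two translations contribute `ζ ^ 8` to fourth powers of eta; after multiplying by it, only
  -- `ζ ^ 12 = -1` is needed.
  apply mul_left_cancel₀ (pow_ne_zero 8 hζ)
  linear_combination h5 + I ^ 2 * τ ^ 2 * eta w ^ 4 * h6 - τ ^ 2 * eta w ^ 4 * I_sq

/-! ### The action of the full modular group -/

/-- The squares of the three theta constants `θ₂`, `θ₃`, `θ₄`, as functions on `ℍ`. -/
noncomputable def thetaSq : Fin 3 → ℍ → ℂ :=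
  ![fun z ↦ thetaTwoSq z, fun z ↦ thetaThreeSq z, fun z ↦ thetaFourSq z]

/-- The exponent `e` and the index `i` such that `θ₂² ∣[1] γ = I ^ e • θᵢ²` for
`γ ≡ (a b; c d)` modulo `4`. -/
def thetaTwoSqSlashIndex (a b c d : ZMod 4) : ZMod 4 × Fin 3 :=
  if 2 * c = 0 then (b * d + 1 - d, 0)
  else if 2 * d = 0 then (a * c - c, 2)
  else (a * c - c, 1)

/-- The exponent and the index describing the action of `T` on the `thetaSq i`. -/
def thetaSqSlashT : Fin 3 → ZMod 4 × Fin 3 := ![(1, 0), (0, 2), (0, 1)]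

/-- The exponent and the index describing the action of `S` on the `thetaSq i`. -/
def thetaSqSlashS : Fin 3 → ZMod 4 × Fin 3 := ![(3, 2), (3, 1), (3, 0)]

/-- Compatibility of the index with right multiplication by a generator is a finite check on
matrices of determinant 1 modulo 4. -/
lemma thetaTwoSqSlashIndex_mul_T (a b c d : ZMod 4) (h : a * d - b * c = 1) :
    thetaTwoSqSlashIndex a (a + b) c (c + d) =
      ((thetaTwoSqSlashIndex a b c d).1 + (thetaSqSlashT (thetaTwoSqSlashIndex a b c d).2).1,
        (thetaSqSlashT (thetaTwoSqSlashIndex a b c d).2).2) := by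
  revert a b c d
  decide

lemma thetaTwoSqSlashIndex_mul_S (a b c d : ZMod 4) (h : a * d - b * c = 1) :
    thetaTwoSqSlashIndex b (-a) d (-c) =
      ((thetaTwoSqSlashIndex a b c d).1 + (thetaSqSlashS (thetaTwoSqSlashIndex a b c d).2).1,
        (thetaSqSlashS (thetaTwoSqSlashIndex a b c d).2).2) := by
  revert a b c d
  decide

/-- The additive character `e ↦ I ^ e` modulo `4`. -/
noncomputable def powI : AddChar (ZMod 4) ℂ := AddChar.zmodChar 4 I_pow_four

lemma powI_one : powI 1 = I := by
  rw [powI, AddChar.zmodChar_apply, show (1 : ZMod 4).val = 1 from rfl, pow_one]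

lemma powI_two : powI 2 = -1 := by
  rw [powI, AddChar.zmodChar_apply, show (2 : ZMod 4).val = 2 from rfl, I_sq]

lemma powI_three : powI 3 = -I := by
  rw [powI, AddChar.zmodChar_apply, show (3 : ZMod 4).val = 3 from rfl, I_pow_three]

lemma thetaSq_slash_T (i : Fin 3) :
    thetaSq i ∣[(1 : ℤ)] ModularGroup.T =
      powI (thetaSqSlashT i).1 • thetaSq (thetaSqSlashT i).2 := by
  ext z
  have h2 : ((ModularGroup.T • z : ℍ) : ℂ) = z + 1 := by
    rw [UpperHalfPlane.modular_T_smul, UpperHalfPlane.coe_vadd, ofReal_one, add_comm]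
  have h1 : denom ModularGroup.T z = 1 := by simp [ModularGroup.denom_apply, ModularGroup.coe_T]
  rw [SL_slash_apply, h1, one_zpow, mul_one, Pi.smul_apply, smul_eq_mul]
  fin_cases i
  · change thetaTwoSq (ModularGroup.T • z : ℍ) = powI 1 * thetaTwoSq z
    rw [h2, powI_one, thetaTwoSq_add_one]
  · change thetaThreeSq (ModularGroup.T • z : ℍ) = powI 0 * thetaFourSq z
    rw [h2, AddChar.map_zero_eq_one, one_mul, thetaThreeSq_add_one]
  · change thetaFourSq (ModularGroup.T • z : ℍ) = powI 0 * thetaThreeSq z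
    rw [h2, AddChar.map_zero_eq_one, one_mul, thetaThreeSq]

lemma thetaSq_slash_S (i : Fin 3) :
    thetaSq i ∣[(1 : ℤ)] ModularGroup.S =
      powI (thetaSqSlashS i).1 • thetaSq (thetaSqSlashS i).2 := by
  ext z
  have h2 : ((ModularGroup.S • z : ℍ) : ℂ) = -1 / z := by
    rw [UpperHalfPlane.modular_S_smul, UpperHalfPlane.coe_mk]
    ring
  have hz := z.ne_zero
  rw [SL_slash_apply, ModularGroup.denom_S, zpow_neg_one, Pi.smul_apply, smul_eq_mul,
    mul_inv_eq_iff_eq_mul₀ hz]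
  fin_cases i
  · change thetaTwoSq (ModularGroup.S • z : ℍ) = powI 3 * thetaFourSq z * z
    rw [h2, powI_three, thetaTwoSq_neg_inv z.2, mul_right_comm]
  · change thetaThreeSq (ModularGroup.S • z : ℍ) = powI 3 * thetaThreeSq z * z
    rw [h2, powI_three, thetaThreeSq_neg_inv z.2, mul_right_comm]
  · change thetaFourSq (ModularGroup.S • z : ℍ) = powI 3 * thetaTwoSq z * z
    rw [h2, powI_three, thetaFourSq_neg_inv z.2, mul_right_comm]

/-- The function `I ^ e • θᵢ²` with `(e, i)` given by `thetaTwoSqSlashIndex`. -/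
noncomputable def thetaTwoSqTranslate (γ : SL(2, ℤ)) : ℍ → ℂ :=
  powI (thetaTwoSqSlashIndex (γ 0 0) (γ 0 1) (γ 1 0) (γ 1 1)).1 •
    thetaSq (thetaTwoSqSlashIndex (γ 0 0) (γ 0 1) (γ 1 0) (γ 1 1)).2

lemma thetaTwoSqTranslate_slash (γ : SL(2, ℤ)) {g : SL(2, ℤ)}
    (hg : g ∈ ({ModularGroup.S, ModularGroup.T} : Set SL(2, ℤ))) :
    thetaTwoSqTranslate γ ∣[(1 : ℤ)] g = thetaTwoSqTranslate (γ * g) := by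
  have hdet : (γ 0 0 : ZMod 4) * γ 1 1 - γ 0 1 * γ 1 0 = 1 := by
    have := γ.det_coe
    rw [Matrix.det_fin_two] at this
    exact_mod_cast congrArg (Int.cast (R := ZMod 4)) this
  rcases hg with rfl | rfl
  · have h := thetaTwoSqSlashIndex_mul_S _ _ _ _ hdet
    rw [thetaTwoSqTranslate, SL_smul_slash, thetaSq_slash_S, smul_smul, ← AddChar.map_add_eq_mul]
    simp [thetaTwoSqTranslate, ModularGroup.coe_S, Matrix.SpecialLinearGroup.coe_mul, Matrix.mul_apply,
      h]
  · have h := thetaTwoSqSlashIndex_mul_T _ _ _ _ hdet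
    rw [thetaTwoSqTranslate, SL_smul_slash, thetaSq_slash_T, smul_smul, ← AddChar.map_add_eq_mul]
    simp [thetaTwoSqTranslate, ModularGroup.coe_T, Matrix.SpecialLinearGroup.coe_mul, Matrix.mul_apply,
      h]

theorem thetaTwoSq_slash (γ : SL(2, ℤ)) :
    thetaSq 0 ∣[(1 : ℤ)] γ = thetaTwoSqTranslate γ := by
  have hγ : γ ∈ Subgroup.closure {ModularGroup.S, ModularGroup.T} := by
    simp [SpecialLinearGroup.SL2Z_generators]
  induction hγ using Subgroup.closure_induction_right with
  | one => simp [thetaTwoSqTranslate, thetaTwoSqSlashIndex]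
  | mul_right x _ y hy ih => rw [SlashAction.slash_mul, ih, thetaTwoSqTranslate_slash x hy]
  | mul_inv_cancel x _ y hy ih =>
    -- The rule for `y` applied at `x * y⁻¹` is inverted to obtain the rule for `y⁻¹`.
    have h := thetaTwoSqTranslate_slash (x * y⁻¹) hy
    rw [inv_mul_cancel_right] at h
    rw [SlashAction.slash_mul, ih, ← h, ← SlashAction.slash_mul, mul_inv_cancel,
      SlashAction.slash_one]

lemma pow_slash_SL2 (f : ℍ → ℂ) (k : ℕ) (γ : SL(2, ℤ)) :
    (f ^ k) ∣[(k : ℤ)] γ = (f ∣[(1 : ℤ)] γ) ^ k := by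
  ext z
  simp only [SL_slash_apply, Pi.pow_apply, mul_pow, zpow_neg, zpow_natCast, zpow_one, inv_pow]

/-! ### Behaviour at infinity and holomorphy -/

/-- The product is holomorphic in `q` on the unit disc, hence continuous at `q = 0`. -/
lemma tendsto_eta_tprod :
    Tendsto (fun z ↦ ∏' n, (1 - eta_q n z)) (comap Complex.im atTop) (𝓝 1) := by
  have h : ContinuousAt (fun q : ℂ ↦ ∏' n : ℕ, (1 - q ^ (n + 1))) 0 :=
    (differentiableOn_tprod_one_sub_pow.differentiableAt
      (Metric.ball_mem_nhds _ one_pos)).continuousAt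
  have h0 : ∏' n : ℕ, (1 - (0 : ℂ) ^ (n + 1)) = 1 := by simp
  rw [ContinuousAt, h0] at h
  exact h.comp ((Periodic.qParam_tendsto one_pos).mono_right nhdsWithin_le_nhds)

lemma tendsto_const_mul_comap_im {r : ℝ} (hr : 0 < r) :
    Tendsto (fun z : ℂ ↦ r * z) (comap Complex.im atTop) (comap Complex.im atTop) := by
  rw [tendsto_comap_iff]
  simpa [Function.comp_def] using tendsto_comap.const_mul_atTop hr

lemma tendsto_add_one_comap_im :
    Tendsto (fun z : ℂ ↦ z + 1) (comap Complex.im atTop) (comap Complex.im atTop) := by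
  rw [tendsto_comap_iff]
  simpa [Function.comp_def] using! (tendsto_comap : Tendsto Complex.im _ atTop)

lemma tendsto_thetaTwoSq : Tendsto thetaTwoSq (comap Complex.im atTop) (𝓝 0) := by
  have h2 := tendsto_eta_tprod.comp (tendsto_const_mul_comap_im two_pos)
  have hq : Tendsto (Periodic.qParam 4) (comap Complex.im atTop) (𝓝 0) :=
    (Periodic.qParam_tendsto four_pos).mono_right nhdsWithin_le_nhds
  have h := (((h2.pow 4).div (tendsto_eta_tprod.pow 2) (by simp)).mul hq).const_mul 4
  simp only [mul_zero] at h
  refine h.congr fun z ↦ ?_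
  -- Leading exponents: `4 · 2/24 = 1/4 + 2/24`, so `θ₂²` vanishes like `q ^ (1/4)`.
  have hz : Periodic.qParam 24 (2 * z) ^ 4 = Periodic.qParam 4 z * Periodic.qParam 24 z ^ 2 := by
    simp only [Periodic.qParam, ← Complex.exp_nat_mul, ← Complex.exp_add]
    congr 1
    push_cast
    ring
  have hne := Periodic.qParam_ne_zero (h := 24) z
  simp only [Function.comp_apply, ofReal_ofNat, thetaTwoSq, eta, mul_pow, hz, Pi.div_apply]
  field_simp

lemma tendsto_thetaFourSq : Tendsto thetaFourSq (comap Complex.im atTop) (𝓝 1) := by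
  have h2 := tendsto_eta_tprod.comp (tendsto_const_mul_comap_im (r := 1 / 2) (by norm_num))
  have h := (h2.pow 4).div (tendsto_eta_tprod.pow 2) (by simp)
  simp only [one_pow, div_one] at h
  refine h.congr fun z ↦ ?_
  have hz : Periodic.qParam 24 (z / 2) ^ 4 = Periodic.qParam 24 z ^ 2 := by
    simp only [Periodic.qParam, ← Complex.exp_nat_mul]
    congr 1
    push_cast
    ring
  have hne := Periodic.qParam_ne_zero (h := 24) z
  simp only [Function.comp_apply, ofReal_div, ofReal_one, ofReal_ofNat, thetaFourSq, eta,
    mul_pow, hz, one_div_mul_eq_div, Pi.div_apply]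
  rw [mul_div_mul_left _ _ (pow_ne_zero 2 hne)]

lemma tendsto_thetaThreeSq : Tendsto thetaThreeSq (comap Complex.im atTop) (𝓝 1) :=
  tendsto_thetaFourSq.comp tendsto_add_one_comap_im

lemma isBoundedAtImInfty_thetaSq (i : Fin 3) : IsBoundedAtImInfty (thetaSq i) := by
  fin_cases i
  · exact (tendsto_thetaTwoSq.comp tendsto_coe_atImInfty).isBigO_one ℝ
  · exact (tendsto_thetaThreeSq.comp tendsto_coe_atImInfty).isBigO_one ℝ
  · exact (tendsto_thetaFourSq.comp tendsto_coe_atImInfty).isBigO_one ℝ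

lemma isBoundedAtImInfty_thetaTwoSq_pow_slash (k : ℕ) (γ : SL(2, ℤ)) :
    IsBoundedAtImInfty ((thetaSq 0 ^ k) ∣[(k : ℤ)] γ) := by
  rw [pow_slash_SL2, thetaTwoSq_slash, thetaTwoSqTranslate]
  exact ((Asymptotics.IsBigO.const_smul_left (isBoundedAtImInfty_thetaSq _) _).pow k).congr
    (fun _ ↦ rfl) (fun _ ↦ one_pow k)

lemma mdifferentiable_thetaTwoSq_pow (k : ℕ) :
    MDifferentiable (modelWithCornersSelf ℂ ℂ) (modelWithCornersSelf ℂ ℂ) (thetaSq 0 ^ k) := by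
  rw [UpperHalfPlane.mdifferentiable_iff]
  have h : DifferentiableOn ℂ (fun z ↦ thetaTwoSq z ^ k) {z | 0 < z.im} := by
    intro z hz
    have h2 : 0 < (2 * z).im := by simpa using hz
    have hd : DifferentiableAt ℂ (fun z ↦ eta (2 * z)) z :=
      (differentiableAt_eta_of_mem_upperHalfPlaneSet h2).comp (f := fun z : ℂ ↦ 2 * z) z
        (by fun_prop)
    exact ((((hd.pow 4).const_mul 4).div ((differentiableAt_eta_of_mem_upperHalfPlaneSet hz).pow 2)
      (pow_ne_zero 2 (eta_ne_zero hz))).pow k).differentiableWithinAt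
  refine h.congr fun z hz ↦ ?_
  simp [thetaSq, ofComplex_apply_of_im_pos hz]

/-! ### The character of `θ₂²` and the Kronecker symbol -/

lemma powI_one_sub {d : ZMod 4} (hd : 2 * d ≠ 0) : powI (1 - d) = (ZMod.χ₄ d : ℂ) := by
  have h : ∀ d : ZMod 4, 2 * d ≠ 0 → d = 1 ∨ d = 3 := by decide
  rcases h d hd with rfl | rfl
  · simp
  · rw [show (1 - 3 : ZMod 4) = 2 from rfl, powI_two, show ZMod.χ₄ 3 = -1 from rfl]
    simp

/-- `θ₂²` has character `χ₄(d)` on `Γ₀(2) ∩ Γ⁰(4)`. -/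
lemma thetaTwoSq_slash_of_dvd {γ : SL(2, ℤ)} (hb : (γ 0 1 : ZMod 4) = 0)
    (hc : 2 * (γ 1 0 : ZMod 4) = 0) :
    thetaSq 0 ∣[(1 : ℤ)] γ = (ZMod.χ₄ (γ 1 1) : ℂ) • thetaSq 0 := by
  have hdet : (γ 0 0 : ZMod 4) * γ 1 1 - γ 0 1 * γ 1 0 = 1 := by
    have := γ.det_coe
    rw [Matrix.det_fin_two] at this
    exact_mod_cast congrArg (Int.cast (R := ZMod 4)) this
  have hd : 2 * (γ 1 1 : ZMod 4) ≠ 0 := by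
    intro h
    rw [hb, zero_mul, sub_zero] at hdet
    have : (2 : ZMod 4) = 0 := by linear_combination (γ 0 0 : ZMod 4) * h - 2 * hdet
    exact absurd this (by decide)
  rw [thetaTwoSq_slash, thetaTwoSqTranslate, thetaTwoSqSlashIndex, if_pos hc, hb, zero_mul,
    zero_add, powI_one_sub hd]

end ModularForm

lemma kroneckerSymbol_neg_one_pow (k : ℕ) {n : ℤ} (hn : IsCoprime n 8) :
    kroneckerSymbol ((-1) ^ k) n = ZMod.χ₄ n ^ k := by
  have hodd : Odd n := by
    rw [← Int.isCoprime_two_right]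
    exact IsCoprime.of_isCoprime_of_dvd_right hn ⟨4, by norm_num⟩
  have hodd' : Odd n.natAbs := Int.natAbs_odd.mpr hodd
  have hn0 : n ≠ 0 := by rintro rfl; simp at hodd
  have hf : n.natAbs.factorization 2 = 0 :=
    Nat.factorization_eq_zero_of_not_dvd (by rwa [← even_iff_two_dvd, Nat.not_even_iff_odd])
  rw [kroneckerSymbol, if_neg hn0, hf, pow_zero, pow_zero, Nat.div_one, mul_one]
  have hχ : ZMod.χ₄ n.natAbs = (-1) ^ (n.natAbs / 2) :=
    ZMod.χ₄_eq_neg_one_pow (Nat.odd_iff.mp hodd')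
  -- `χ₄(-1) = -1` matches the sign convention for negative `n` when `(-1) ^ k < 0`.
  have hneg : ZMod.χ₄ (n : ZMod 4) = (if n < 0 then -1 else 1) * ZMod.χ₄ n.natAbs := by
    split_ifs with h
    · have : (n : ZMod 4) = -1 * (n.natAbs : ZMod 4) := by
        rw [← Int.cast_natCast, Int.ofNat_natAbs_of_nonpos h.le]
        simp
      rw [this, map_mul]
      rfl
    · rw [one_mul, ← Int.cast_natCast n.natAbs, Int.natAbs_of_nonneg (not_lt.mp h)]
  rcases Nat.even_or_odd k with hk | hk
  · rw [hneg, hχ, mul_pow, ← pow_mul, (hk.mul_left _).neg_one_pow, hk.neg_one_pow,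
      jacobiSym.one_left]
    split_ifs <;> simp_all
  · have h2 : (ZMod.χ₄ n.natAbs) ^ k = ZMod.χ₄ n.natAbs := by
      rw [hχ, ← pow_mul, mul_comm, pow_mul, hk.neg_one_pow]
    rw [hneg, hk.neg_one_pow, jacobiSym.at_neg_one hodd', mul_pow, h2]
    split_ifs <;> simp_all [hk.neg_one_pow]

namespace ModularForm

open UpperHalfPlane hiding I
open Complex Function Filter Topology OnePoint

/-! ### Rescaling by `diag(4, 1)` -/

/-- The matrix `(4 0; 0 1)`. -/
noncomputable def diagFourOne (K : Type*) [Field K] [CharZero K] : GL (Fin 2) K :=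
  Matrix.GeneralLinearGroup.mkOfDetNeZero !![4, 0; 0, 1] (by simp)

lemma diagFourOne_map : (diagFourOne ℚ).map (Rat.castHom ℝ) = diagFourOne ℝ := by
  ext i j
  fin_cases i <;> fin_cases j <;> simp [diagFourOne, Matrix.GeneralLinearGroup.mkOfDetNeZero]

lemma det_diagFourOne : (diagFourOne ℝ).det.val = 4 := by
  simp [diagFourOne, Matrix.GeneralLinearGroup.mkOfDetNeZero]

lemma coe_diagFourOne_smul (z : ℍ) : ((diagFourOne ℝ • z : ℍ) : ℂ) = 4 * z := by
  rw [coe_smul_of_det_pos (by rw [det_diagFourOne]; norm_num)]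
  simp [num, denom, diagFourOne, Matrix.GeneralLinearGroup.mkOfDetNeZero]

lemma σ_diagFourOne (x : ℂ) : σ (diagFourOne ℝ) x = x := by
  rw [σ, if_pos (by rw [det_diagFourOne]; norm_num)]
  rfl

/-- The eta quotient `η(8z)^(4k) / η(4z)^(2k)`. -/
noncomputable def etaQuotient (k : ℕ) (z : ℍ) : ℂ :=
  eta (8 * (z : ℂ)) ^ (4 * k) / eta (4 * (z : ℂ)) ^ (2 * k)

/-- In the constant, `4 ^ k` comes from the factor 4 in `θ₂²`, and `4 ^ (k - 1)` from the
determinant in the slash action. -/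
lemma etaQuotient_eq_smul_slash (k : ℕ) :
    etaQuotient k = ((4 : ℂ) ^ k * 4 ^ ((k : ℤ) - 1))⁻¹ •
      ((thetaSq 0 ^ k) ∣[(k : ℤ)] diagFourOne ℝ) := by
  ext z
  have hd : denom (diagFourOne ℝ) z = 1 := by
    simp [denom, diagFourOne, Matrix.GeneralLinearGroup.mkOfDetNeZero]
  have h4 : (4 : ℂ) ^ ((k : ℤ) - 1) ≠ 0 := zpow_ne_zero _ (by norm_num)
  rw [Pi.smul_apply, slash_apply, hd, det_diagFourOne, σ_diagFourOne, one_zpow, mul_one,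
    Pi.pow_apply, smul_eq_mul]
  have : thetaSq 0 (diagFourOne ℝ • z) = 4 * (eta (8 * z) ^ 4 / eta (4 * z) ^ 2) := by
    change thetaTwoSq (diagFourOne ℝ • z : ℍ) = _
    rw [coe_diagFourOne_smul, thetaTwoSq, ← mul_assoc, mul_div_assoc]
    norm_num
  rw [this, etaQuotient, mul_pow, div_pow, ← pow_mul, ← pow_mul]
  simp only [abs_of_pos (four_pos : (0 : ℝ) < 4), ofReal_ofNat]
  field_simp

/-- Conjugation by `diag(4, 1)` turns `(a b; 8c d)` into `(a 4b; 2c d)`. -/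
lemma exists_diagFourOne_mul_eq {γ : SL(2, ℤ)} (hγ : γ ∈ CongruenceSubgroup.Gamma0 8) :
    ∃ γ' : SL(2, ℤ), (γ' 0 1 : ZMod 4) = 0 ∧ 2 * (γ' 1 0 : ZMod 4) = 0 ∧ γ' 1 1 = γ 1 1 ∧
      diagFourOne ℝ * Matrix.SpecialLinearGroup.mapGL ℝ γ =
        Matrix.SpecialLinearGroup.mapGL ℝ γ' * diagFourOne ℝ := by
  rw [CongruenceSubgroup.Gamma0_mem, ZMod.intCast_zmod_eq_zero_iff_dvd] at hγ
  obtain ⟨c, hc⟩ := hγ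
  have hdet := γ.det_coe
  rw [Matrix.det_fin_two, hc] at hdet
  obtain ⟨δ, h00, h01, h10, h11⟩ : ∃ δ : SL(2, ℤ),
      δ 0 0 = γ 0 0 ∧ δ 0 1 = 4 * γ 0 1 ∧ δ 1 0 = 2 * c ∧ δ 1 1 = γ 1 1 :=
    ⟨⟨!![γ 0 0, 4 * γ 0 1; 2 * c, γ 1 1], by
      rw [Matrix.det_fin_two_of]
      linear_combination hdet⟩, rfl, rfl, rfl, rfl⟩
  refine ⟨δ, ?_, ?_, h11, ?_⟩
  · simp [h01, show (4 : ZMod 4) = 0 from rfl]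
  · simp [h10, ← mul_assoc, show (2 * 2 : ZMod 4) = 0 from rfl]
  · ext i j
    fin_cases i <;> fin_cases j <;>
      simp [diagFourOne, Matrix.GeneralLinearGroup.mkOfDetNeZero, Matrix.mul_apply, hc, h00, h01,
        h10, h11] <;>
      ring

theorem etaQuotient_slash (k : ℕ) {γ : SL(2, ℤ)} (hγ : γ ∈ CongruenceSubgroup.Gamma0 8) :
    etaQuotient k ∣[(k : ℤ)] γ = ((ZMod.χ₄ (γ 1 1) : ℂ) ^ k) • etaQuotient k := by
  obtain ⟨γ', hb, hc, hd, h⟩ := exists_diagFourOne_mul_eq hγ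
  have hcomm : ((thetaSq 0 ^ k) ∣[(k : ℤ)] diagFourOne ℝ) ∣[(k : ℤ)] γ =
      ((thetaSq 0 ^ k) ∣[(k : ℤ)] γ') ∣[(k : ℤ)] diagFourOne ℝ := by
    have : ((thetaSq 0 ^ k) ∣[(k : ℤ)] diagFourOne ℝ) ∣[(k : ℤ)]
        Matrix.SpecialLinearGroup.mapGL ℝ γ = ((thetaSq 0 ^ k) ∣[(k : ℤ)]
          Matrix.SpecialLinearGroup.mapGL ℝ γ') ∣[(k : ℤ)] diagFourOne ℝ := by
      rw [← SlashAction.slash_mul, h, SlashAction.slash_mul]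
    exact this
  rw [etaQuotient_eq_smul_slash, SL_smul_slash, hcomm, pow_slash_SL2,
    thetaTwoSq_slash_of_dvd hb hc, smul_pow, smul_slash, σ_diagFourOne, hd, smul_comm]

lemma isBoundedAt_etaQuotient (k : ℕ) {c : OnePoint ℝ} (hc : IsCusp c 𝒮ℒ) :
    IsBoundedAt c (etaQuotient k) k := by
  -- A rational conjugate of `SL(2, ℤ)` is arithmetic, so it has the same cusps.
  have hc' : IsCusp (diagFourOne ℝ • c) 𝒮ℒ := by
    have := CongruenceSubgroup.isArithmetic_conj_SL2Z (diagFourOne ℚ)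
    rw [diagFourOne_map] at this
    exact (Subgroup.IsArithmetic.isCusp_iff_isCusp_SL2Z _).mp (hc.smul (diagFourOne ℝ))
  have h : IsBoundedAt (diagFourOne ℝ • c) (thetaSq 0 ^ k) k :=
    (isBoundedAt_iff_forall_SL2Z hc').mpr fun γ _ ↦ isBoundedAtImInfty_thetaTwoSq_pow_slash k γ
  rw [IsBoundedAt.smul_iff] at h
  intro g hg
  rw [etaQuotient_eq_smul_slash, smul_slash]
  exact Asymptotics.IsBigO.const_smul_left (h g hg) _

/-- The eta quotient `η(8z)^(4k) / η(4z)^(2k)` as a modular form of weight `k` on `Γ₁(8)`. -/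
noncomputable def etaQuotientModularForm (k : ℕ) : ModularForm
    ((CongruenceSubgroup.Gamma1 8).map (Matrix.SpecialLinearGroup.mapGL ℝ)) (k : ℤ) where
  toFun := etaQuotient k
  slash_action_eq' := by
    rintro _ ⟨γ, hγ, rfl⟩
    have h := etaQuotient_slash k (CongruenceSubgroup.Gamma1_in_Gamma0 8 hγ)
    have hd : (γ 1 1 : ZMod 4) = 1 := by
      have h1 := ((CongruenceSubgroup.Gamma1_mem 8 γ).mp hγ).2.1
      rw [← ZMod.cast_intCast (show 4 ∣ 8 by norm_num), h1, ZMod.cast_one (by norm_num)]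
    rwa [hd, map_one, Int.cast_one, one_pow, one_smul] at h
  holo' := by
    change MDifferentiable _ _ (etaQuotient k)
    rw [etaQuotient_eq_smul_slash]
    exact ((mdifferentiable_thetaTwoSq_pow k).slash k _).const_smul _
  bdd_at_cusps' hc := by
    refine isBoundedAt_etaQuotient k (hc.mono ?_)
    rintro _ ⟨γ, -, rfl⟩
    exact ⟨γ, rfl⟩

/-! ### The character modulo 8 and the conclusion -/

/-- The `k`-th power of the nontrivial Dirichlet character modulo `4`, with modulus `8`. -/
noncomputable def chiFourPow (k : ℕ) : DirichletCharacter ℂ 8 :=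
  DirichletCharacter.changeLevel (show 4 ∣ 8 by norm_num)
    (ZMod.χ₄.ringHomComp (Int.castRingHom ℂ)) ^ k

lemma chiFourPow_apply (k : ℕ) {n : ℤ} (hn : IsCoprime n 8) :
    chiFourPow k (n : ZMod 8) = (ZMod.χ₄ n : ℂ) ^ k := by
  have hu : IsUnit (n : ZMod 8) := by
    rw [← ZMod.coe_unitOfIsCoprime n hn]
    exact Units.isUnit _
  obtain ⟨u, hu⟩ := hu
  rw [chiFourPow, ← hu, MulChar.pow_apply_coe, hu,
    DirichletCharacter.changeLevel_eq_cast_of_dvd' _ _ hn]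
  rfl

end ModularForm

theorem mainTheorem10 (k : ℕ) :
    ∃ χ : DirichletCharacter ℂ 8,
      (∀ n : ℤ, IsCoprime n 8 → χ (n : ZMod 8) = (kroneckerSymbol ((-1) ^ k) n : ℂ)) ∧
      ∃ f ∈ modularFormsWithCharacter (k : ℤ) 8 χ,
        ∀ z : UpperHalfPlane,
          f z = ModularForm.eta (8 * (z : ℂ)) ^ (4 * k) / ModularForm.eta (4 * (z : ℂ)) ^ (2 * k) := by
  refine ⟨ModularForm.chiFourPow k, fun n hn ↦ ?_, ModularForm.etaQuotientModularForm k,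
    fun γ hγ ↦ ?_, fun z ↦ rfl⟩
  · rw [ModularForm.chiFourPow_apply k hn, kroneckerSymbol_neg_one_pow k hn, Int.cast_pow]
  · have hd : IsCoprime (γ 1 1) 8 := by
      rw [CongruenceSubgroup.Gamma0_mem, ZMod.intCast_zmod_eq_zero_iff_dvd] at hγ
      obtain ⟨c, hc⟩ := hγ
      have hdet := γ.det_coe
      rw [Matrix.det_fin_two, hc] at hdet
      exact ⟨γ 0 0, -(γ 0 1 * c), by linear_combination hdet⟩
    rw [ModularForm.chiFourPow_apply k hd]
    exact ModularForm.etaQuotient_slash k hγ
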